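/- Let $X$ be an Archimedean (real) vector lattice. A net $(x_\alpha)$ in $X$ converges (relatively) uniformly to $x\in X$ if there is $e\in X_+$ such that for every $\varepsilon>0$ one has $|x_\alpha-x|\le\varepsilon e$ for all sufficiently large $\alpha$; a subset of $X$ is uniformly closed if it contains the limit of every uniformly convergent net of its elements. A sublattice of $X$ is a linear subspace closed under the lattice operations $\vee$ and $\wedge$, and a linear subspace $Y$ has codimension $n$ if $\dim(X/Y)=n$. Let $n\ge 0$ be an integer and let $Y$ be a uniformly closed sublattice of $X$ of codimension $n$. Then there are uniformly closed sublattices $Z_1,\dots,Z_n$ of $X$, each of codimension $1$, such that $$Y=\bigcap_{i=1}^n Z_i .$$ Moreover, there are lattice homomorphisms $\varphi_1,\dots,\varphi_{2n}\colon X\to\mathbb R$ (that is, linear functionals preserving $\vee$ and $\wedge$) such that $Z_i=\ker(\varphi_{2i-1}-\varphi_{2i})$ for $i=1,\dots,n$, and hence $$Y=\bigcap_{i=1}^n\ker(\varphi_{2i-1}-\varphi_{2i}).$$ (For $n=0$ the empty intersection is $X$.) -/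

import Mathlib

/-- A vector lattice is Archimedean if `0 ≤ x` and `n x ≤ y` for all `n` force `x = 0`.
(Mathlib's class `Archimedean` is a different, much stronger property on a lattice that is not
linearly ordered: it would make every element `> 0` a strong unit.) -/
def IsArchimedeanVectorLattice (X : Type*) [AddCommGroup X] [Lattice X] : Prop :=
  ∀ x y : X, 0 ≤ x → (∀ n : ℕ, n • x ≤ y) → x = 0

/-- Relative uniform convergence of a net `f` to `x`: for some `e ≥ 0`, one has
`‖f i - x‖_e → 0`, where `‖z‖_e = inf {c > 0 : |z| ≤ c e}` (infinite if there is no such `c`);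
that is, for each `ε > 0`, eventually `|f i - x| ≤ ε e`. -/
def UniformlyConvergesTo {X : Type*} [AddCommGroup X] [Lattice X] [Module ℝ X]
    {ι : Type*} [Preorder ι] (f : ι → X) (x : X) : Prop :=
  ∃ e : X, 0 ≤ e ∧ ∀ ε : ℝ, 0 < ε → ∃ i₀ : ι, ∀ i, i₀ ≤ i → |f i - x| ≤ ε • e

/-- A set is uniformly closed if it contains the limits of all its relatively uniformly
convergent nets. -/
def IsUniformlyClosed.{u} {X : Type u} [AddCommGroup X] [Lattice X] [Module ℝ X]
    (A : Set X) : Prop :=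
  ∀ (ι : Type u) [Preorder ι] [IsDirectedOrder ι] [Nonempty ι] (f : ι → X) (x : X),
    (∀ i, f i ∈ A) → UniformlyConvergesTo f x → x ∈ A

/-- A uniformly closed sublattice of codimension `n`: a linear subspace, closed under the
lattice operations, uniformly closed, and with `dim (X / Y) = n`. -/
structure IsUniformlyClosedSublatticeOfCodim {X : Type*} [AddCommGroup X] [Lattice X]
    [Module ℝ X] (n : ℕ) (Y : Submodule ℝ X) : Prop where
  isSublattice : IsSublattice (Y : Set X)
  isUniformlyClosed : IsUniformlyClosed (Y : Set X)
  codim : Module.rank ℝ (X ⧸ Y) = n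

/-- A linear functional that is a lattice homomorphism into `ℝ`. -/
structure IsRealLatticeHom {X : Type*} [AddCommGroup X] [Lattice X] [Module ℝ X]
    (φ : X →ₗ[ℝ] ℝ) : Prop where
  map_sup : ∀ x y : X, φ (x ⊔ y) = φ x ⊔ φ y
  map_inf : ∀ x y : X, φ (x ⊓ y) = φ x ⊓ φ y

/-!
The idea is that modulo a suitable ideal the vector lattice `X` becomes finite-dimensional, where
sublattices can be described by Kakutani's argument.

Let `I` be the largest solid subspace (ideal) contained in `Y`, see `Submodule.solidCore`; it is
uniformly closed because `Y` is. Positive elements outside `I` that are pairwise disjoint modulo `I`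
dominate elements outside `Y`. Since `Y` is a sublattice, every relation `∑ cᵢ yᵢ ∈ Y` between
these entails `∑ |cᵢ| yᵢ ∈ Y`, and a dimension count in `X ⧸ Y` shows that there are at most `2 n`
of them (`card_le_two_mul_finrank_quotient`). Each member `a` of a largest such family is an atom
modulo `I`, so the elements disjoint from `a` modulo `I` form a prime, uniformly closed solid
subspace. Such a subspace is the kernel of a real lattice homomorphism
(`exists_isRealLatticeHom_ker_eq`), and by maximality the intersection of the finitely many kernels
lies in `Y` (`exists_finset_isRealLatticeHom`).

Two lattice homomorphisms map `Y` onto a sublattice of the plane, which if proper lies on a line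
`α s = β t` with `0 ≤ α` and `0 ≤ β`. A supremum of infima, as in the Stone–Weierstrass theorem,
then shows that `Y` is cut out by functionals of the form `α φ - β ψ`
(`exists_isRealLatticeHom_sub_ne`), which are differences of lattice homomorphisms. Any such family
spans the `n`-dimensional dual of `X ⧸ Y`, and a basis chosen from it gives the claim.
-/

/-! ### Inequalities in vector lattices -/

section LatticeGroup

variable {X : Type*} [AddCommGroup X] [Lattice X] [IsOrderedAddMonoid X]

lemma sub_inf_le_of_le_add {y u v : X} (hv : 0 ≤ v) (h : y ≤ u + v) : y - y ⊓ u ≤ v := by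
  rw [inf_eq_sub_posPart_sub, sub_sub_cancel, posPart_def]
  exact sup_le (sub_le_iff_le_add'.2 h) hv

lemma add_inf_le_inf_add_inf {a b c : X} (ha : 0 ≤ a) (hb : 0 ≤ b) (hc : 0 ≤ c) :
    (a + b) ⊓ c ≤ a ⊓ c + b ⊓ c := by
  set t := (a + b) ⊓ c
  have ht : 0 ≤ t := le_inf (add_nonneg ha hb) hc
  have h1 : t - t ⊓ a ≤ b := sub_inf_le_of_le_add hb inf_le_left
  have h2 : t - t ⊓ a ≤ c := (sub_le_self _ (le_inf ht ha)).trans inf_le_right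
  have h3 : t ⊓ a ≤ a ⊓ c := le_inf inf_le_right (inf_le_left.trans inf_le_right)
  calc t = t ⊓ a + (t - t ⊓ a) := by abel
    _ ≤ a ⊓ c + b ⊓ c := add_le_add h3 (le_inf h1 h2)

lemma abs_posPart_sub_posPart_le (x y : X) : |x⁺ - y⁺| ≤ |x - y| :=
  abs_sup_sub_sup_le_abs x y 0

lemma abs_negPart_sub_negPart_le (x y : X) : |x⁻ - y⁻| ≤ |x - y| := by
  rw [← posPart_neg, ← posPart_neg]
  refine (abs_posPart_sub_posPart_le _ _).trans_eq ?_
  rw [neg_sub_neg, abs_sub_comm]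

lemma posPart_le_abs (x : X) : x⁺ ≤ |x| := by
  rw [← posPart_add_negPart]; exact le_add_of_nonneg_right (negPart_nonneg x)

lemma negPart_le_abs (x : X) : x⁻ ≤ |x| := by
  rw [← posPart_add_negPart]; exact le_add_of_nonneg_left (posPart_nonneg x)

lemma abs_sup_sub_sup_le (x y u v : X) : |x ⊔ y - u ⊔ v| ≤ |x - u| + |y - v| := by
  have h : x ⊔ y - u ⊔ v = (x ⊔ y - u ⊔ y) + (y ⊔ u - v ⊔ u) := by
    rw [sup_comm u y, sup_comm v u]; abel
  rw [h]
  exact (abs_add_le _ _).trans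
    (add_le_add (abs_sup_sub_sup_le_abs x u y) (abs_sup_sub_sup_le_abs y v u))

lemma abs_inf_sub_inf_le (x y u v : X) : |x ⊓ y - u ⊓ v| ≤ |x - u| + |y - v| := by
  have h : x ⊓ y - u ⊓ v = (x ⊓ y - u ⊓ y) + (y ⊓ u - v ⊓ u) := by
    rw [inf_comm u y, inf_comm v u]; abel
  rw [h]
  exact (abs_add_le _ _).trans
    (add_le_add (abs_inf_sub_inf_le_abs x u y) (abs_inf_sub_inf_le_abs y v u))

lemma add_sub_abs_sub_eq (x y : X) : x + y - |x - y| = x ⊓ y + x ⊓ y := by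
  rw [abs_sub_comm, ← two_nsmul_inf_eq_add_sub_abs_sub, two_nsmul]

end LatticeGroup

open LatticeOrderedAddCommGroup (IsSolid)

section VectorLattice

variable {X : Type*} [AddCommGroup X] [Lattice X] [Module ℝ X]

/-- A set containing every element that it approximates, relative to some `e`, with arbitrary
precision. This is uniform closedness stated without nets. -/
def ContainsUniformLimits (A : Set X) : Prop :=
  ∀ x e : X, (∀ ε : ℝ, 0 < ε → ∃ y ∈ A, |y - x| ≤ ε • e) → x ∈ A

section

variable [IsOrderedModule ℝ X]

lemma smul_sup_of_nonneg {c : ℝ} (hc : 0 ≤ c) (x y : X) : c • (x ⊔ y) = c • x ⊔ c • y := by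
  rcases hc.eq_or_lt with rfl | hc
  · simp
  · exact (OrderIso.smulRight (β := X) hc).map_sup x y

lemma smul_inf_of_nonneg {c : ℝ} (hc : 0 ≤ c) (x y : X) : c • (x ⊓ y) = c • x ⊓ c • y := by
  rcases hc.eq_or_lt with rfl | hc
  · simp
  · exact (OrderIso.smulRight (β := X) hc).map_inf x y

lemma abs_smul_of_nonneg {c : ℝ} (hc : 0 ≤ c) (x : X) : |c • x| = c • |x| := by
  rw [abs, abs, smul_sup_of_nonneg hc, smul_neg]

lemma abs_smul_eq (c : ℝ) (x : X) : |c • x| = |c| • |x| := by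
  rcases le_total 0 c with h | h
  · rw [abs_smul_of_nonneg h, abs_of_nonneg h]
  · rw [← abs_neg, ← neg_smul, abs_smul_of_nonneg (neg_nonneg.2 h), abs_of_nonpos h]

end

variable [IsOrderedAddMonoid X]

/-! ### Solid subspaces -/

lemma LatticeOrderedAddCommGroup.IsSolid.mem_of_nonneg_of_le {I : Submodule ℝ X}
    (hI : IsSolid (I : Set X)) {x y : X} (hx : x ∈ I) (hy : 0 ≤ y) (hyx : y ≤ x) : y ∈ I :=
  hI hx (by rwa [abs_of_nonneg hy, abs_of_nonneg (hy.trans hyx)])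

lemma LatticeOrderedAddCommGroup.IsSolid.abs_mem_iff {I : Submodule ℝ X}
    (hI : IsSolid (I : Set X)) {x : X} : |x| ∈ I ↔ x ∈ I :=
  ⟨fun h => hI h (abs_abs x).ge, fun h => hI h (abs_abs x).le⟩

lemma inf_sum_mem {ι : Type*} {I : Submodule ℝ X} (hI : IsSolid (I : Set X)) {z : X} (hz : 0 ≤ z)
    (s : Finset ι) (x : ι → X) (hx : ∀ i ∈ s, 0 ≤ x i) (h : ∀ i ∈ s, x i ⊓ z ∈ I) :
    (∑ i ∈ s, x i) ⊓ z ∈ I := by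
  classical
  induction s using Finset.induction_on with
  | empty => simp [inf_eq_left.2 hz]
  | insert i s hi ih =>
    rw [Finset.forall_mem_insert] at hx h
    have hs := Finset.sum_nonneg hx.2
    rw [Finset.sum_insert hi]
    exact hI.mem_of_nonneg_of_le (I.add_mem h.1 (ih hx.2 h.2)) (le_inf (add_nonneg hx.1 hs) hz)
      (add_inf_le_inf_add_inf hx.1 hs hz)

variable [IsOrderedModule ℝ X]

lemma inf_smul_of_nonneg {a : X} (ha : 0 ≤ a) (s t : ℝ) : (s ⊓ t) • a = s • a ⊓ t • a := by
  rcases le_total s t with h | h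
  · rw [inf_eq_left.2 h, inf_eq_left.2 (smul_le_smul_of_nonneg_right h ha)]
  · rw [inf_eq_right.2 h, inf_eq_right.2 (smul_le_smul_of_nonneg_right h ha)]

lemma sup_smul_of_nonneg {a : X} (ha : 0 ≤ a) (s t : ℝ) : (s ⊔ t) • a = s • a ⊔ t • a := by
  rcases le_total s t with h | h
  · rw [sup_eq_right.2 h, sup_eq_right.2 (smul_le_smul_of_nonneg_right h ha)]
  · rw [sup_eq_left.2 h, sup_eq_left.2 (smul_le_smul_of_nonneg_right h ha)]

lemma IsUniformlyClosed.containsUniformLimits {A : Set X} (hA : IsUniformlyClosed A) :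
    ContainsUniformLimits A := by
  intro x e h
  have he : 0 ≤ e := by
    obtain ⟨y, -, hy⟩ := h 1 one_pos
    rw [one_smul] at hy
    exact (abs_nonneg _).trans hy
  choose f hfA hf using fun n : ℕ => h (1 / ((n : ℝ) + 1)) Nat.one_div_pos_of_nat
  refine hA (ULift ℕ) (fun i => f i.down) x (fun i => hfA _) ⟨e, he, fun ε hε => ?_⟩
  obtain ⟨n, hn⟩ := exists_nat_one_div_lt hε
  refine ⟨⟨n⟩, fun i hi => (hf _).trans (smul_le_smul_of_nonneg_right ?_ he)⟩
  exact (Nat.one_div_le_one_div (α := ℝ) (ULift.down_le.2 hi)).trans hn.le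

/-- The largest solid subspace contained in a given subspace `Y`: the elements `x` for which the
order interval from `0` to `|x|` lies in `Y`. -/
def Submodule.solidCore (Y : Submodule ℝ X) : Submodule ℝ X where
  carrier := {x | ∀ y, 0 ≤ y → y ≤ |x| → y ∈ Y}
  zero_mem' := by
    intro y hy h
    rw [abs_zero] at h
    rw [le_antisymm h hy]
    exact Y.zero_mem
  add_mem' := by
    intro u v hu hv y hy h
    have h' : y ≤ |u| + |v| := h.trans (abs_add_le u v)
    have h1 := hu (y ⊓ |u|) (le_inf hy (abs_nonneg u)) inf_le_right
    have h2 := hv (y - y ⊓ |u|) (sub_nonneg.2 inf_le_left)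
      (sub_inf_le_of_le_add (abs_nonneg v) h')
    simpa using Y.add_mem h1 h2
  smul_mem' := by
    intro c x hx y hy h
    rw [abs_smul_eq] at h
    rcases (abs_nonneg c).eq_or_lt with hc | hc
    · rw [← hc, zero_smul] at h
      rw [le_antisymm h hy]
      exact Y.zero_mem
    · have := hx (|c|⁻¹ • y) (smul_nonneg (inv_nonneg.2 hc.le) hy)
        ((inv_smul_le_iff_of_pos hc).2 h)
      simpa [smul_smul, hc.ne'] using Y.smul_mem |c| this

lemma Submodule.mem_solidCore {Y : Submodule ℝ X} {x : X} :
    x ∈ Y.solidCore ↔ ∀ y, 0 ≤ y → y ≤ |x| → y ∈ Y := Iff.rfl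

lemma Submodule.isSolid_solidCore (Y : Submodule ℝ X) : IsSolid (Y.solidCore : Set X) :=
  fun _ hx _ hyx z hz hzy => hx z hz (hzy.trans hyx)

lemma Submodule.solidCore_le (Y : Submodule ℝ X) : Y.solidCore ≤ Y := by
  intro x hx
  rw [← posPart_sub_negPart x]
  exact Y.sub_mem (hx _ (posPart_nonneg x) (posPart_le_abs x))
    (hx _ (negPart_nonneg x) (negPart_le_abs x))

lemma Submodule.containsUniformLimits_solidCore {Y : Submodule ℝ X}
    (hY : ContainsUniformLimits (Y : Set X)) :
    ContainsUniformLimits (Y.solidCore : Set X) := by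
  intro x e h y hy hyx
  refine hY y e fun ε hε => ?_
  obtain ⟨z, hz, hzx⟩ := h ε hε
  refine ⟨|z| ⊓ y, hz _ (le_inf (abs_nonneg z) hy) inf_le_left, ?_⟩
  calc |(|z| ⊓ y) - y| = |(|z| ⊓ y) - |x| ⊓ y| := by rw [inf_eq_right.2 hyx]
    _ ≤ |(|z| - |x|)| := abs_inf_sub_inf_le_abs _ _ _
    _ ≤ |z - x| := abs_abs_sub_abs_le z x
    _ ≤ ε • e := hzx

/-- The elements disjoint from `a` modulo the solid subspace `I`. -/
def Submodule.disjointModulo (I : Submodule ℝ X) (hI : IsSolid (I : Set X)) (a : X)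
    (ha : 0 ≤ a) : Submodule ℝ X where
  carrier := {x | |x| ⊓ a ∈ I}
  zero_mem' := by simp [inf_eq_left.2 ha]
  add_mem' := by
    intro x y hx hy
    refine hI.mem_of_nonneg_of_le (I.add_mem hx hy) (le_inf (abs_nonneg _) ha) ?_
    exact (inf_le_inf_right a (abs_add_le x y)).trans
      (add_inf_le_inf_add_inf (abs_nonneg x) (abs_nonneg y) ha)
  smul_mem' := by
    intro c x hx
    refine hI.mem_of_nonneg_of_le (I.smul_mem (|c| + 1) hx) (le_inf (abs_nonneg _) ha) ?_
    have hc : (0 : ℝ) ≤ |c| + 1 := by positivity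
    rw [smul_inf_of_nonneg hc, abs_smul_eq]
    refine inf_le_inf (smul_le_smul_of_nonneg_right (by linarith) (abs_nonneg x)) ?_
    exact le_smul_of_one_le_left ha (by linarith [abs_nonneg c])

lemma Submodule.mem_disjointModulo {I : Submodule ℝ X} {hI : IsSolid (I : Set X)} {a : X}
    {ha : 0 ≤ a} {x : X} : x ∈ I.disjointModulo hI a ha ↔ |x| ⊓ a ∈ I := Iff.rfl

lemma Submodule.isSolid_disjointModulo {I : Submodule ℝ X} (hI : IsSolid (I : Set X)) {a : X}
    (ha : 0 ≤ a) : IsSolid (I.disjointModulo hI a ha : Set X) :=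
  fun _ hx _ hyx => hI.mem_of_nonneg_of_le hx (le_inf (abs_nonneg _) ha) (inf_le_inf_right a hyx)

lemma Submodule.containsUniformLimits_disjointModulo {I : Submodule ℝ X}
    (hI : IsSolid (I : Set X)) (hIc : ContainsUniformLimits (I : Set X)) {a : X} (ha : 0 ≤ a) :
    ContainsUniformLimits (I.disjointModulo hI a ha : Set X) := by
  intro x e h
  refine hIc _ e fun ε hε => ?_
  obtain ⟨z, hz, hzx⟩ := h ε hε
  exact ⟨|z| ⊓ a, hz, (abs_inf_sub_inf_le_abs _ _ _).trans
    ((abs_abs_sub_abs_le z x).trans hzx)⟩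

/-! ### Real lattice homomorphisms from prime solid subspaces -/

/-- Otherwise `P` would contain `ε • (ε⁻¹ • a - x)⁺` for every `ε > 0`, which is within `ε • |x|`
of `a`, and hence it would contain `a`. -/
lemma exists_posPart_sub_smul_notMem {P : Submodule ℝ X}
    (hPc : ContainsUniformLimits (P : Set X)) {a : X} (ha : 0 ≤ a) (haP : a ∉ P) (x : X) :
    ∃ t : ℝ, (t • a - x)⁺ ∉ P := by
  by_contra! h
  refine haP (hPc a |x| fun ε hε => ⟨ε • (ε⁻¹ • a - x)⁺, P.smul_mem _ (h _), ?_⟩)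
  have h1 : a = ε • (ε⁻¹ • a)⁺ := by
    rw [posPart_of_nonneg (smul_nonneg (inv_nonneg.2 hε.le) ha), smul_smul,
      mul_inv_cancel₀ hε.ne', one_smul]
  calc |ε • (ε⁻¹ • a - x)⁺ - a| = |ε • ((ε⁻¹ • a - x)⁺ - (ε⁻¹ • a)⁺)| := by
        rw [smul_sub, ← h1]
    _ = ε • |(ε⁻¹ • a - x)⁺ - (ε⁻¹ • a)⁺| := abs_smul_of_nonneg hε.le _
    _ ≤ ε • |(ε⁻¹ • a - x) - (ε⁻¹ • a)| :=
        smul_le_smul_of_nonneg_left (abs_posPart_sub_posPart_le _ _) hε.le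
    _ = ε • |x| := by rw [sub_sub_cancel_left, abs_neg]

/-- The cases of interest are `g u = u⁺` and `g u = u⁻`. -/
lemma isClosed_setOf_smul_sub_mem {P : Submodule ℝ X} (hPc : ContainsUniformLimits (P : Set X))
    {g : X → X} (hg : ∀ u v, |g u - g v| ≤ |u - v|) {a : X} (ha : 0 ≤ a) (x : X) :
    IsClosed {t : ℝ | g (t • a - x) ∈ P} := by
  refine isClosed_of_closure_subset fun t ht => hPc _ a fun ε hε => ?_
  obtain ⟨s, hs, hst⟩ := Metric.mem_closure_iff.1 ht ε hε
  refine ⟨_, hs, (hg _ _).trans ?_⟩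
  rw [sub_sub_sub_cancel_right, ← sub_smul, abs_smul_eq, abs_of_nonneg ha]
  rw [dist_comm, Real.dist_eq] at hst
  exact smul_le_smul_of_nonneg_right hst.le ha

/-- Modulo a prime, uniformly closed solid subspace `P` the space is spanned by any positive `a`
outside `P`: the closed sets of scalars `t` with `t • a ≤ x`, respectively `x ≤ t • a`, modulo `P`
are nonempty and cover the line, so they meet. -/
lemma exists_sub_smul_mem {P : Submodule ℝ X}
    (hPc : ContainsUniformLimits (P : Set X)) (hP : ∀ x : X, x⁺ ∈ P ∨ x⁻ ∈ P)
    {a : X} (ha : 0 ≤ a) (haP : a ∉ P) (x : X) : ∃ t : ℝ, x - t • a ∈ P := by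
  have hL := isClosed_setOf_smul_sub_mem hPc (g := fun u => u⁺) abs_posPart_sub_posPart_le ha x
  have hU := isClosed_setOf_smul_sub_mem hPc (g := fun u => u⁻) abs_negPart_sub_negPart_le ha x
  obtain ⟨s, hs⟩ := exists_posPart_sub_smul_notMem hPc ha haP x
  obtain ⟨r, hr⟩ := exists_posPart_sub_smul_notMem hPc ha haP (-x)
  have hr' : ((-r) • a - x)⁻ ∉ P := by
    rwa [← posPart_neg, neg_sub, neg_smul, sub_neg_eq_add, add_comm, ← sub_neg_eq_add]
  obtain ⟨t, -, ht1, ht2⟩ := isPreconnected_closed_iff.1 (isPreconnected_univ (α := ℝ)) _ _ hL hU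
    (fun t _ => hP _) ⟨-r, trivial, (hP _).resolve_right hr'⟩ ⟨s, trivial, (hP _).resolve_left hs⟩
  refine ⟨t, ?_⟩
  rw [← neg_sub, ← posPart_sub_negPart (t • a - x)]
  exact P.neg_mem (P.sub_mem ht1 ht2)

/-- A prime, uniformly closed, proper solid subspace is the kernel of a real lattice
homomorphism. -/
lemma exists_isRealLatticeHom_ker_eq {P : Submodule ℝ X} (hPs : IsSolid (P : Set X))
    (hPc : ContainsUniformLimits (P : Set X)) (hP : ∀ x : X, x⁺ ∈ P ∨ x⁻ ∈ P)
    {a : X} (ha : 0 ≤ a) (haP : a ∉ P) :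
    ∃ φ : X →ₗ[ℝ] ℝ, IsRealLatticeHom φ ∧ LinearMap.ker φ = P := by
  choose f hf using exists_sub_smul_mem hPc hP ha haP
  have huniq : ∀ {x : X} {t : ℝ}, x - t • a ∈ P → f x = t := by
    intro x t h
    by_contra hne
    have h1 : (f x - t) • a ∈ P := by
      have := P.sub_mem h (hf x)
      rwa [sub_sub_sub_cancel_left, ← sub_smul] at this
    exact haP ((P.smul_mem_iff (sub_ne_zero.2 hne)).1 h1)
  refine ⟨{ toFun := f, map_add' := fun x y => huniq ?_, map_smul' := fun c x => huniq ?_ },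
    ⟨fun x y => huniq ?_, fun x y => huniq ?_⟩, ?_⟩
  · convert P.add_mem (hf x) (hf y) using 1
    module
  · convert P.smul_mem c (hf x) using 1
    simp only [RingHom.id_apply, smul_eq_mul]
    module
  · refine hPs (P.add_mem (hPs.abs_mem_iff.2 (hf x)) (hPs.abs_mem_iff.2 (hf y))) ?_
    rw [sup_smul_of_nonneg ha]
    exact (abs_sup_sub_sup_le _ _ _ _).trans (le_abs_self _)
  · refine hPs (P.add_mem (hPs.abs_mem_iff.2 (hf x)) (hPs.abs_mem_iff.2 (hf y))) ?_
    rw [inf_smul_of_nonneg ha]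
    exact (abs_inf_sub_inf_le _ _ _ _).trans (le_abs_self _)
  · ext x
    refine ⟨fun h => ?_, fun h => huniq (by simpa using h)⟩
    have h0 : f x = 0 := h
    simpa [h0] using hf x

/-! ### Counting elements that are disjoint modulo a solid subspace -/

/-- Nonzero vectors all of whose linear relations remain relations after taking absolute values of
the coefficients: there are at most twice as many as the dimension. Dividing out the line of one
vector `q i` kills at most one further vector `q j`: such a `q j` is a negative multiple of `q i`,
and two of them would be positive multiples of each other. -/
lemma card_le_two_mul_finrank {ι : Type*} (n : ℕ) {E : Type*} [AddCommGroup E]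
    [Module ℝ E] [FiniteDimensional ℝ E] (hn : Module.finrank ℝ E = n) (s : Finset ι) (q : ι → E)
    (hq : ∀ i ∈ s, q i ≠ 0)
    (hrel : ∀ c : ι → ℝ, ∑ i ∈ s, c i • q i = 0 → ∑ i ∈ s, |c i| • q i = 0) :
    s.card ≤ 2 * n := by
  classical
  induction n generalizing E s with
  | zero =>
    have := Module.finrank_zero_iff.1 hn
    rw [Finset.card_eq_zero.2 (Finset.eq_empty_of_forall_notMem fun i hi =>
      hq i hi (Subsingleton.elim _ _))]
  | succ n ih =>
    rcases s.eq_empty_or_nonempty with rfl | ⟨i, hi⟩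
    · simp
    set L : Submodule ℝ E := ℝ ∙ q i
    -- A relation `q j - t • q k = 0` entails `q j + t • q k = 0`, hence `q j = 0`.
    have hpair : ∀ j ∈ s, ∀ k ∈ s, j ≠ k → ∀ t : ℝ, 0 < t → q j ≠ t • q k := by
      intro j hj k hk hjk t ht h
      have hsum : ∀ a b : ℝ, ∑ l ∈ s, (Pi.single j a + Pi.single k b : ι → ℝ) l • q l
          = a • q j + b • q k := by
        intro a b
        simp only [Pi.add_apply, add_smul, Finset.sum_add_distrib, Pi.single_apply, ite_smul,
          zero_smul, Finset.sum_ite_eq', hj, hk, if_true]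
      have h1 := hrel (Pi.single j 1 + Pi.single k (-t)) (by rw [hsum, h]; module)
      have h2 : ∀ l, |(Pi.single j 1 + Pi.single k (-t) : ι → ℝ) l|
          = (Pi.single j 1 + Pi.single k t : ι → ℝ) l := by
        intro l
        by_cases hlj : l = j
        · subst hlj; simp [hjk]
        · by_cases hlk : l = k
          · subst hlk; simp [hlj, abs_of_pos ht]
          · simp [hlj, hlk]
      simp only [h2] at h1
      rw [hsum, ← h, one_smul, ← two_smul ℝ] at h1
      exact hq j hj ((smul_eq_zero.1 h1).resolve_left two_ne_zero)
    -- The vectors outside `L` inherit the hypotheses in the quotient: a relation modulo `L` is a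
    -- relation that also involves `q i`.
    set s' := s.filter fun j => q j ∉ L
    have hs' : s'.card ≤ 2 * n := by
      refine ih (E := E ⧸ L) ?_ s' (fun j => L.mkQ (q j)) ?_ ?_
      · have h1 := L.finrank_quotient_add_finrank
        rw [finrank_span_singleton (hq i hi)] at h1
        omega
      · intro j hj h
        exact (Finset.mem_filter.1 hj).2 ((Submodule.Quotient.mk_eq_zero L).1 h)
      · intro c hc
        have h1 : ∑ j ∈ s', c j • q j ∈ L := by
          rw [← Submodule.Quotient.mk_eq_zero, ← Submodule.mkQ_apply, map_sum]
          simpa using hc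
        obtain ⟨d, hd⟩ := Submodule.mem_span_singleton.1 h1
        have hi' : i ∉ s' := by simp [s', L, Submodule.mem_span_singleton_self]
        have hsum : ∀ g : ι → ℝ, (∀ j ∈ s, j ∉ s' → j ≠ i → g j = 0) →
            ∑ j ∈ s, g j • q j = ∑ j ∈ s', g j • q j + g i • q i := by
          intro g hg
          rw [add_comm, ← Finset.sum_insert (f := fun j => g j • q j) hi']
          symm
          refine Finset.sum_subset (Finset.insert_subset hi (Finset.filter_subset _ _)) ?_
          intro j hj hj'
          rw [Finset.mem_insert, not_or] at hj'
          rw [hg j hj hj'.2 hj'.1, zero_smul]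
        set g : ι → ℝ := fun j => if j ∈ s' then c j else if j = i then -d else 0
        have hg' : ∀ j ∈ s', g j = c j := fun j hj => if_pos hj
        have hgi : g i = -d := by simp [g, hi']
        have hg0 : ∀ j ∈ s, j ∉ s' → j ≠ i → g j = 0 := by
          intro j _ h1 h2; simp [g, h1, h2]
        have h2 := hrel g (by
          rw [hsum g hg0, hgi, Finset.sum_congr rfl fun j hj => by rw [hg' j hj], ← hd]
          module)
        rw [hsum (fun j => |g j|) fun j h1 h2 h3 => by rw [hg0 j h1 h2 h3, abs_zero],
          Finset.sum_congr rfl fun j hj => by rw [hg' j hj]] at h2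
        have h3 : ∑ j ∈ s', |c j| • q j ∈ L := by
          rw [eq_neg_of_add_eq_zero_left h2]
          exact L.neg_mem (L.smul_mem _ (Submodule.mem_span_singleton_self _))
        rw [← Submodule.Quotient.mk_eq_zero, ← Submodule.mkQ_apply, map_sum] at h3
        simpa using h3
    -- The vectors in `L` other than `q i` are negative multiples of `q i`.
    have hrest : ((s.filter fun j => ¬ q j ∉ L).erase i).card ≤ 1 := by
      refine Finset.card_le_one.2 fun j hj k hk => ?_
      by_contra hjk
      simp only [Finset.mem_erase, Finset.mem_filter, not_not] at hj hk
      have hneg : ∀ l ∈ s, l ≠ i → q l ∈ L → ∃ t : ℝ, t < 0 ∧ q l = t • q i := by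
        intro l hl hli hlL
        obtain ⟨t, ht⟩ := Submodule.mem_span_singleton.1 hlL
        refine ⟨t, lt_of_not_ge fun h0 => ?_, ht.symm⟩
        rcases h0.eq_or_lt with rfl | h0
        · exact hq l hl (by rw [← ht, zero_smul])
        · exact hpair l hl i hi hli t h0 ht.symm
      obtain ⟨t, ht, hjt⟩ := hneg j hj.2.1 hj.1 hj.2.2
      obtain ⟨r, hr, hkr⟩ := hneg k hk.2.1 hk.1 hk.2.2
      refine hpair j hj.2.1 k hk.2.1 hjk (t / r) (div_pos_of_neg_of_neg ht hr) ?_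
      rw [hjt, hkr, smul_smul, div_mul_cancel₀ _ hr.ne]
    have h1 := Finset.card_filter_add_card_filter_not (s := s) (fun j => q j ∉ L)
    have h2 := Finset.pred_card_le_card_erase (s := s.filter fun j => ¬ q j ∉ L) (a := i)
    change s'.card + _ = _ at h1
    omega

lemma smul_inf_smul_mem {I : Submodule ℝ X} (hI : IsSolid (I : Set X)) {x y : X} (hx : 0 ≤ x)
    (hy : 0 ≤ y) (h : x ⊓ y ∈ I) {s t : ℝ} (hs : 0 ≤ s) (ht : 0 ≤ t) : s • x ⊓ t • y ∈ I := by
  refine hI.mem_of_nonneg_of_le (I.smul_mem (s + t) h)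
    (le_inf (smul_nonneg hs hx) (smul_nonneg ht hy)) ?_
  rw [smul_inf_of_nonneg (add_nonneg hs ht)]
  exact inf_le_inf (smul_le_smul_of_nonneg_right (by linarith) hx)
    (smul_le_smul_of_nonneg_right (by linarith) hy)

/-- For positive elements that are disjoint modulo `I`, taking the absolute value of a linear
combination amounts, modulo `I`, to taking absolute values of the coefficients. -/
lemma sum_abs_smul_sub_abs_sum_smul_mem {ι : Type*} {I : Submodule ℝ X}
    (hI : IsSolid (I : Set X)) (s : Finset ι) (x : ι → X) (hx : ∀ i ∈ s, 0 ≤ x i)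
    (h : ∀ i ∈ s, ∀ j ∈ s, i ≠ j → x i ⊓ x j ∈ I) (c : ι → ℝ) :
    ∑ i ∈ s, |c i| • x i - |∑ i ∈ s, c i • x i| ∈ I := by
  have hp : ∀ i ∈ s, 0 ≤ (c i)⁺ • x i := fun i hi => smul_nonneg (posPart_nonneg _) (hx i hi)
  have hm : ∀ i ∈ s, 0 ≤ (c i)⁻ • x i := fun i hi => smul_nonneg (negPart_nonneg _) (hx i hi)
  have h1 : ∑ i ∈ s, |c i| • x i = ∑ i ∈ s, (c i)⁺ • x i + ∑ i ∈ s, (c i)⁻ • x i := by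
    rw [← Finset.sum_add_distrib]
    exact Finset.sum_congr rfl fun i _ => by rw [← add_smul, posPart_add_negPart]
  have h2 : ∑ i ∈ s, c i • x i = ∑ i ∈ s, (c i)⁺ • x i - ∑ i ∈ s, (c i)⁻ • x i := by
    rw [← Finset.sum_sub_distrib]
    exact Finset.sum_congr rfl fun i _ => by rw [← sub_smul, posPart_sub_negPart]
  have h3 : (∑ i ∈ s, (c i)⁺ • x i) ⊓ (∑ i ∈ s, (c i)⁻ • x i) ∈ I := by
    refine inf_sum_mem hI (Finset.sum_nonneg hm) s _ hp fun i hi => ?_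
    rw [inf_comm]
    refine inf_sum_mem hI (hp i hi) s _ hm fun j hj => ?_
    rcases eq_or_ne j i with rfl | hji
    · rcases le_total 0 (c j) with h0 | h0
      · rw [negPart_eq_zero.2 h0, zero_smul, inf_eq_left.2 (hp j hi)]
        exact I.zero_mem
      · rw [posPart_eq_zero.2 h0, zero_smul, inf_eq_right.2 (hm j hi)]
        exact I.zero_mem
    · exact smul_inf_smul_mem hI (hx j hj) (hx i hi) (h j hj i hi hji) (negPart_nonneg _)
        (posPart_nonneg _)
  rw [h1, h2, add_sub_abs_sub_eq]
  exact I.add_mem h3 h3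

/-- A family of positive elements outside the largest solid subspace of a sublattice `Y`, disjoint
modulo that subspace, has at most twice as many members as the codimension of `Y`: below each
member there is an element outside `Y`. -/
lemma card_le_two_mul_finrank_quotient {Y : Submodule ℝ X} (hY : IsSublattice (Y : Set X))
    [FiniteDimensional ℝ (X ⧸ Y)] (S : Finset X) (hS : ∀ a ∈ S, 0 ≤ a ∧ a ∉ Y.solidCore)
    (hdisj : ∀ a ∈ S, ∀ b ∈ S, a ≠ b → a ⊓ b ∈ Y.solidCore) :
    S.card ≤ 2 * Module.finrank ℝ (X ⧸ Y) := by
  classical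
  have hex : ∀ a : X, ∃ y : X, a ∈ S → 0 ≤ y ∧ y ≤ a ∧ y ∉ Y := by
    intro a
    by_cases ha : a ∈ S
    · have h1 := (hS a ha).2
      rw [Submodule.mem_solidCore, abs_of_nonneg (hS a ha).1] at h1
      push Not at h1
      obtain ⟨y, h1, h2, h3⟩ := h1
      exact ⟨y, fun _ => ⟨h1, h2, h3⟩⟩
    · exact ⟨0, fun h => absurd h ha⟩
  choose y hy using hex
  refine card_le_two_mul_finrank _ rfl S (fun a => Y.mkQ (y a)) ?_ ?_
  · intro a ha h
    exact (hy a ha).2.2 ((Submodule.Quotient.mk_eq_zero Y).1 h)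
  · intro c hc
    have h1 : ∑ a ∈ S, c a • y a ∈ Y := by
      rw [← Submodule.Quotient.mk_eq_zero, ← Submodule.mkQ_apply, map_sum]
      simpa using hc
    have h2 : |∑ a ∈ S, c a • y a| ∈ Y := hY.supClosed h1 (Y.neg_mem h1)
    have h3 := sum_abs_smul_sub_abs_sum_smul_mem Y.isSolid_solidCore S y (fun a ha => (hy a ha).1)
      (fun a ha b hb hab => Y.isSolid_solidCore.mem_of_nonneg_of_le (hdisj a ha b hb hab)
        (le_inf (hy a ha).1 (hy b hb).1) (inf_le_inf (hy a ha).2.1 (hy b hb).2.1)) c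
    have h4 : ∑ a ∈ S, |c a| • y a ∈ Y := by
      simpa using Y.add_mem (Y.solidCore_le h3) h2
    rw [← Submodule.Quotient.mk_eq_zero, ← Submodule.mkQ_apply, map_sum] at h4
    simpa using h4

/-- A member `a` of a disjoint family of maximal size cannot be replaced by two disjoint elements
below it; hence the elements disjoint from `a` modulo the largest solid subspace of `Y` form a prime
solid subspace, the kernel of a real lattice homomorphism. -/
lemma exists_finset_isRealLatticeHom {Y : Submodule ℝ X} (hY : IsSublattice (Y : Set X))
    (hYc : ContainsUniformLimits (Y : Set X)) [FiniteDimensional ℝ (X ⧸ Y)] :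
    ∃ F : Finset (X →ₗ[ℝ] ℝ), (∀ φ ∈ F, IsRealLatticeHom φ) ∧
      ∀ x : X, (∀ φ ∈ F, φ x = 0) → x ∈ Y := by
  classical
  set I := Y.solidCore
  have hI : IsSolid (I : Set X) := Y.isSolid_solidCore
  let p : Finset X → Prop := fun S =>
    (∀ a ∈ S, 0 ≤ a ∧ a ∉ I) ∧ ∀ a ∈ S, ∀ b ∈ S, a ≠ b → a ⊓ b ∈ I
  obtain ⟨S, hS, hmax⟩ : ∃ S, p S ∧ ∀ T, p T → T.card ≤ S.card := by
    have hbdd : BddAbove (Finset.card '' {S | p S}) := by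
      refine ⟨2 * Module.finrank ℝ (X ⧸ Y), ?_⟩
      rintro _ ⟨S, hS, rfl⟩
      exact card_le_two_mul_finrank_quotient hY S hS.1 hS.2
    obtain ⟨S, hS, hSc⟩ := Nat.sSup_mem (Set.image_nonempty.2 ⟨∅, by simp [p]⟩) hbdd
    exact ⟨S, hS, fun T hT => (le_csSup hbdd ⟨T, hT, rfl⟩).trans hSc.ge⟩
  -- Otherwise replacing `a` by `u` and `v` would give a larger family.
  have hprime : ∀ a ∈ S, ∀ u v : X, 0 ≤ u → u ≤ a → 0 ≤ v → v ≤ a → u ⊓ v ∈ I →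
      u ∈ I ∨ v ∈ I := by
    intro a ha u v hu hua hv hva huv
    by_contra! hcon
    have hnot : ∀ w, 0 ≤ w → w ≤ a → w ∉ I → w ∉ S.erase a := by
      intro w _ hwa hw h
      rw [Finset.mem_erase] at h
      exact hw (by simpa [inf_eq_left.2 hwa] using hS.2 w h.2 a ha h.1)
    have huv' : u ≠ v := by
      rintro rfl
      exact hcon.1 (by simpa using huv)
    have hsmall : ∀ w, 0 ≤ w → w ≤ a → ∀ b ∈ S.erase a, w ⊓ b ∈ I := by
      intro w hw hwa b hb
      rw [Finset.mem_erase] at hb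
      exact hI.mem_of_nonneg_of_le (hS.2 a ha b hb.2 hb.1.symm) (le_inf hw (hS.1 b hb.2).1)
        (inf_le_inf_right b hwa)
    have hT : p (insert u (insert v (S.erase a))) := by
      constructor
      · intro b hb
        simp only [Finset.mem_insert] at hb
        rcases hb with rfl | rfl | hb
        · exact ⟨hu, hcon.1⟩
        · exact ⟨hv, hcon.2⟩
        · exact hS.1 b (Finset.mem_of_mem_erase hb)
      · intro b hb c hc hbc
        simp only [Finset.mem_insert] at hb hc
        rcases hb with rfl | rfl | hb <;> rcases hc with rfl | rfl | hc
        · exact absurd rfl hbc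
        · exact huv
        · exact hsmall _ hu hua c hc
        · rwa [inf_comm]
        · exact absurd rfl hbc
        · exact hsmall _ hv hva c hc
        · rw [inf_comm]; exact hsmall _ hu hua b hb
        · rw [inf_comm]; exact hsmall _ hv hva b hb
        · exact hS.2 b (Finset.mem_of_mem_erase hb) c (Finset.mem_of_mem_erase hc) hbc
    have h1 := hmax _ hT
    rw [Finset.card_insert_of_notMem, Finset.card_insert_of_notMem (hnot v hv hva hcon.2),
      Finset.card_erase_of_mem ha] at h1
    · have := Finset.card_pos.2 ⟨a, ha⟩
      omega
    · rw [Finset.mem_insert, not_or]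
      exact ⟨huv', hnot u hu hua hcon.1⟩
  have hφ : ∀ a : S, ∃ φ : X →ₗ[ℝ] ℝ, IsRealLatticeHom φ ∧
      ∀ x, φ x = 0 → |x| ⊓ (a : X) ∈ I := by
    rintro ⟨a, haS⟩
    have ha := (hS.1 a haS).1
    have hP : ∀ x : X, x⁺ ∈ I.disjointModulo hI a ha ∨ x⁻ ∈ I.disjointModulo hI a ha := by
      intro x
      rw [Submodule.mem_disjointModulo, Submodule.mem_disjointModulo,
        abs_of_nonneg (posPart_nonneg x), abs_of_nonneg (negPart_nonneg x)]
      refine hprime a haS _ _ (le_inf (posPart_nonneg x) ha) inf_le_right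
        (le_inf (negPart_nonneg x) ha) inf_le_right ?_
      rw [inf_inf_inf_comm, posPart_inf_negPart_eq_zero, inf_idem, inf_eq_left.2 ha]
      exact I.zero_mem
    have haP : a ∉ I.disjointModulo hI a ha := by
      rw [Submodule.mem_disjointModulo, abs_of_nonneg ha, inf_idem]
      exact (hS.1 a haS).2
    obtain ⟨φ, hφ, hker⟩ := exists_isRealLatticeHom_ker_eq (I.isSolid_disjointModulo hI ha)
      (Submodule.containsUniformLimits_disjointModulo hI
        (Submodule.containsUniformLimits_solidCore hYc) ha) hP ha haP
    exact ⟨φ, hφ, fun x hx => hker.le (LinearMap.mem_ker.2 hx)⟩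
  choose φ hφ hφ0 using hφ
  refine ⟨Finset.univ.image φ, fun χ hχ => ?_, fun x hx => ?_⟩
  · obtain ⟨a, -, rfl⟩ := Finset.mem_image.1 hχ
    exact hφ a
  have hx' : ∀ a ∈ S, |x| ⊓ a ∈ I := fun a ha => hφ0 ⟨a, ha⟩ x (hx _ (by simp))
  refine Y.solidCore_le ?_
  -- Otherwise `|x|` would enlarge the family.
  by_contra hxI
  have hxI' : |x| ∉ I := fun h => hxI (hI.abs_mem_iff.1 h)
  have hxS : |x| ∉ S := fun h => hxI' (by simpa using hx' _ h)
  have h1 := hmax (insert |x| S) ⟨?_, ?_⟩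
  · rw [Finset.card_insert_of_notMem hxS] at h1
    omega
  · intro b hb
    rcases Finset.mem_insert.1 hb with rfl | hb
    · exact ⟨abs_nonneg x, hxI'⟩
    · exact hS.1 b hb
  · intro b hb c hc hbc
    rcases Finset.mem_insert.1 hb with rfl | hb <;> rcases Finset.mem_insert.1 hc with rfl | hc
    · exact absurd rfl hbc
    · exact hx' c hc
    · rw [inf_comm]; exact hx' b hb
    · exact hS.2 b hb c hc hbc

end VectorLattice

/-! ### Differences of two lattice homomorphisms -/

section Differences

variable {X : Type*} [AddCommGroup X] [Lattice X] [Module ℝ X]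

namespace IsRealLatticeHom

variable {φ ψ : X →ₗ[ℝ] ℝ}

lemma map_abs (hφ : IsRealLatticeHom φ) (x : X) : φ |x| = |φ x| := by
  rw [abs, hφ.map_sup, map_neg, abs]

lemma smul (hφ : IsRealLatticeHom φ) {c : ℝ} (hc : 0 ≤ c) : IsRealLatticeHom (c • φ) where
  map_sup x y := by simp [hφ.map_sup, mul_max_of_nonneg _ _ hc]
  map_inf x y := by simp [hφ.map_inf, mul_min_of_nonneg _ _ hc]

lemma monotone (hφ : IsRealLatticeHom φ) : Monotone φ := fun x y h => by
  rw [← sup_eq_right.2 h, hφ.map_sup]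
  exact le_sup_left

lemma isSublattice_ker_sub (hφ : IsRealLatticeHom φ) (hψ : IsRealLatticeHom ψ) :
    IsSublattice (LinearMap.ker (φ - ψ) : Set X) := by
  constructor
  all_goals
    intro x hx y hy
    simp only [SetLike.mem_coe, LinearMap.mem_ker, LinearMap.sub_apply, sub_eq_zero] at hx hy ⊢
    simp [hφ.map_sup, hψ.map_sup, hφ.map_inf, hψ.map_inf, hx, hy]

lemma isUniformlyClosed_ker_sub (hφ : IsRealLatticeHom φ) (hψ : IsRealLatticeHom ψ) :
    IsUniformlyClosed (LinearMap.ker (φ - ψ) : Set X) := by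
  rintro ι _ _ _ f x hf ⟨e, he, h⟩
  rw [SetLike.mem_coe, LinearMap.mem_ker, LinearMap.sub_apply, sub_eq_zero]
  have hφe : 0 ≤ φ e := by simpa using hφ.monotone he
  have hψe : 0 ≤ ψ e := by simpa using hψ.monotone he
  refine eq_of_forall_dist_le fun ε hε => ?_
  have hpos : 0 < φ e + ψ e + 1 := by linarith
  obtain ⟨i, hi⟩ := h (ε / (φ e + ψ e + 1)) (div_pos hε hpos)
  have hi := hi i le_rfl
  have h1 := hφ.monotone hi
  have h2 := hψ.monotone hi
  have h3 := hf i
  rw [SetLike.mem_coe, LinearMap.mem_ker, LinearMap.sub_apply, sub_eq_zero] at h3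
  rw [hφ.map_abs, map_sub, map_smul, smul_eq_mul] at h1
  rw [hψ.map_abs, map_sub, map_smul, smul_eq_mul] at h2
  rw [Real.dist_eq]
  calc |φ x - ψ x| = |(ψ (f i) - ψ x) - (φ (f i) - φ x)| := by rw [h3]; congr 1; ring
    _ ≤ |ψ (f i) - ψ x| + |φ (f i) - φ x| := abs_sub _ _
    _ ≤ ε / (φ e + ψ e + 1) * (φ e + ψ e) := by linarith
    _ ≤ ε / (φ e + ψ e + 1) * (φ e + ψ e + 1) :=
        mul_le_mul_of_nonneg_left (by linarith) (div_pos hε hpos).le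
    _ = ε := div_mul_cancel₀ _ hpos.ne'

lemma isUniformlyClosedSublatticeOfCodim_ker_sub (hφ : IsRealLatticeHom φ)
    (hψ : IsRealLatticeHom ψ) (h : φ - ψ ≠ 0) :
    IsUniformlyClosedSublatticeOfCodim 1 (LinearMap.ker (φ - ψ)) where
  isSublattice := hφ.isSublattice_ker_sub hψ
  isUniformlyClosed := hφ.isUniformlyClosed_ker_sub hψ
  codim := by
    have e := (φ - ψ).quotKerEquivOfSurjective (LinearMap.surjective h)
    rw [Nat.cast_one, Module.rank_eq_one_iff_finrank_eq_one, e.finrank_eq, Module.finrank_self]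

/-- The values of two lattice homomorphisms on a sublattice fill the plane, or a line `α s = β t`
with `0 ≤ α` and `0 ≤ β`, or only the origin. -/
lemma exists_smul_eq_smul_of_forall_ne (hφ : IsRealLatticeHom φ) (hψ : IsRealLatticeHom ψ)
    {Y : Submodule ℝ X} (hY : IsSublattice (Y : Set X)) (x : X)
    (h : ∀ y ∈ Y, φ y = φ x → ψ y ≠ ψ x) :
    ∃ α β : ℝ, 0 ≤ α ∧ 0 ≤ β ∧ (∀ y ∈ Y, α * φ y = β * ψ y) ∧ α * φ x ≠ β * ψ x := by
  by_cases h0 : ∀ y ∈ Y, φ y = 0 ∧ ψ y = 0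
  · by_cases hx : φ x = 0
    · have hx' := h 0 Y.zero_mem (by simp [hx])
      refine ⟨0, 1, le_rfl, zero_le_one, fun y hy => by simp [(h0 y hy).2], ?_⟩
      simpa using hx'
    · exact ⟨1, 0, zero_le_one, le_rfl, fun y hy => by simp [(h0 y hy).1], by simpa using hx⟩
  push Not at h0
  obtain ⟨y₀, hy₀, hne⟩ := h0
  have hz : |y₀| ∈ Y := hY.supClosed hy₀ (Y.neg_mem hy₀)
  have hu : φ |y₀| = |φ y₀| := hφ.map_abs y₀
  have hv : ψ |y₀| = |ψ y₀| := hψ.map_abs y₀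
  refine ⟨|ψ y₀|, |φ y₀|, abs_nonneg _, abs_nonneg _, fun y hy => ?_, fun hx => ?_⟩
  · -- By Cramer's rule, a nonzero determinant would make the values of `|y₀|` and `y` span the
    -- plane.
    by_contra hdet
    have hd : |ψ y₀| * φ y - |φ y₀| * ψ y ≠ 0 := sub_ne_zero.2 hdet
    set d := |ψ y₀| * φ y - |φ y₀| * ψ y
    refine h (((φ y * ψ x - ψ y * φ x) / d) • |y₀| + ((|ψ y₀| * φ x - |φ y₀| * ψ x) / d) • y)
      (Y.add_mem (Y.smul_mem _ hz) (Y.smul_mem _ hy)) ?_ ?_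
    · simp only [map_add, map_smul, smul_eq_mul, hu]
      field_simp
      simp only [d]; ring
    · simp only [map_add, map_smul, smul_eq_mul, hv]
      field_simp
      simp only [d]; ring
  · by_cases hφ0 : φ y₀ = 0
    · have hψ0 := abs_ne_zero.2 (hne hφ0)
      rw [hφ0, abs_zero, zero_mul] at hx
      have hφx := (mul_eq_zero.1 hx).resolve_left hψ0
      refine h ((ψ x / |ψ y₀|) • |y₀|) (Y.smul_mem _ hz) ?_ ?_
      · simp [hu, hφ0, hφx]
      · simp [hv, div_mul_cancel₀ _ hψ0]
    · have hφ0 := abs_ne_zero.2 hφ0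
      refine h ((φ x / |φ y₀|) • |y₀|) (Y.smul_mem _ hz) ?_ ?_
      · simp [hu, div_mul_cancel₀ _ hφ0]
      · simp only [map_smul, smul_eq_mul, hv]
        field_simp
        linarith

end IsRealLatticeHom

/-- If `Y` could match the values at `x` of any two of the finitely many homomorphisms, then, as in
the Stone–Weierstrass theorem, a supremum of infima of the matching elements would agree with `x`
under all homomorphisms. -/
lemma exists_isRealLatticeHom_sub_ne {Y : Submodule ℝ X} (hY : IsSublattice (Y : Set X))
    {F : Finset (X →ₗ[ℝ] ℝ)} (hF : ∀ φ ∈ F, IsRealLatticeHom φ)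
    (hFY : ∀ x : X, (∀ φ ∈ F, φ x = 0) → x ∈ Y) {x : X} (hx : x ∉ Y) :
    ∃ φ ψ : X →ₗ[ℝ] ℝ, IsRealLatticeHom φ ∧ IsRealLatticeHom ψ ∧ (∀ y ∈ Y, φ y = ψ y) ∧
      φ x ≠ ψ x := by
  by_contra! hcon
  have hmatch : ∀ φ ψ : X →ₗ[ℝ] ℝ, ∃ y ∈ Y, φ ∈ F → ψ ∈ F → φ y = φ x ∧ ψ y = ψ x := by
    intro φ ψ
    by_contra! h
    obtain ⟨hφ, hψ, -⟩ := h 0 Y.zero_mem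
    obtain ⟨α, β, hα, hβ, h1, h2⟩ := (hF φ hφ).exists_smul_eq_smul_of_forall_ne (hF ψ hψ) hY x
      fun y hy => (h y hy).2.2
    exact h2 (hcon _ _ ((hF φ hφ).smul hα) ((hF ψ hψ).smul hβ) h1)
  choose y hyY hy using hmatch
  rcases F.eq_empty_or_nonempty with rfl | hne
  · exact hx (hFY x (by simp))
  set z := F.sup' hne fun φ => F.inf' hne (y φ)
  have hz : z ∈ Y := Finset.sup'_mem (Y : Set X) (fun _ ha _ hb => hY.supClosed ha hb) _ _ _
    fun φ _ => Finset.inf'_mem (Y : Set X) (fun _ ha _ hb => hY.infClosed ha hb) _ _ _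
      fun ψ _ => hyY φ ψ
  refine hx ?_
  rw [← sub_add_cancel x z]
  refine Y.add_mem (hFY _ fun φ hφ => ?_) hz
  rw [map_sub, sub_eq_zero]
  have h1 : φ z = F.sup' hne fun χ => F.inf' hne fun ψ => φ (y χ ψ) := by
    rw [Finset.apply_sup'_eq_sup'_comp _ _ (hF φ hφ).map_sup]
    congr 1
    ext χ
    exact Finset.apply_inf'_eq_inf'_comp _ _ (hF φ hφ).map_inf
  rw [h1]
  apply le_antisymm
  · refine Finset.le_sup'_of_le _ hφ (Finset.le_inf' _ _ fun ψ hψ => (hy φ ψ hφ hψ).1.ge)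
  · refine Finset.sup'_le _ _ fun χ hχ => Finset.inf'_le_of_le _ hφ (hy χ φ hχ hφ).2.le

end Differences

/-! ### Selecting as many functionals as the codimension -/

/-- If functionals vanishing on a subspace `Y` of codimension `n` separate the points outside `Y`
from `Y`, then some `n` of them, none zero, do: they span the dual of the quotient. -/
lemma exists_fin_iInf_ker_eq {K V : Type*} [Field K] [AddCommGroup V] [Module K V]
    {Y : Submodule K V} {n : ℕ} (hn : Module.rank K (V ⧸ Y) = n) (s : Set (V →ₗ[K] K))
    (hs : ∀ f ∈ s, Y ≤ LinearMap.ker f) (hsep : ∀ x ∉ Y, ∃ f ∈ s, f x ≠ 0) :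
    ∃ f : Fin n → (V →ₗ[K] K), (∀ i, f i ∈ s ∧ f i ≠ 0) ∧ Y = ⨅ i, LinearMap.ker (f i) := by
  have : FiniteDimensional K (V ⧸ Y) :=
    Module.rank_lt_aleph0_iff.1 (hn ▸ Cardinal.natCast_lt_aleph0)
  have hfin : Module.finrank K (V ⧸ Y) = n := Module.finrank_eq_of_rank_eq hn
  set t : Set (Module.Dual K (V ⧸ Y)) := {g | g ∘ₗ Y.mkQ ∈ s}
  have hspan : Submodule.span K t = ⊤ := by
    rw [← Subspace.dualCoannihilator_dualAnnihilator_eq (W := Submodule.span K t)]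
    have : (Submodule.span K t).dualCoannihilator = ⊥ := by
      rw [eq_bot_iff]
      intro q hq
      obtain ⟨x, rfl⟩ := Y.mkQ_surjective q
      rw [Submodule.mem_bot, Submodule.mkQ_apply, Submodule.Quotient.mk_eq_zero]
      by_contra hx
      obtain ⟨f, hf, hfx⟩ := hsep x hx
      rw [Submodule.mem_dualCoannihilator] at hq
      refine hfx (hq (Y.liftQ f (hs f hf)) (Submodule.subset_span ?_))
      simpa [t] using hf
    rw [this, Submodule.dualAnnihilator_bot]
  obtain ⟨b, hbt, hb, hli⟩ := exists_linearIndependent K t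
  rw [hspan] at hb
  let B := Module.Basis.mk hli (by simp [hb])
  have : Fintype b := FiniteDimensional.fintypeBasisIndex B
  have hcard : Fintype.card b = n := by
    rw [← Module.finrank_eq_card_basis B, Subspace.dual_finrank_eq, hfin]
  let e := (Fintype.equivFinOfCardEq hcard).symm
  refine ⟨fun i => (e i : Module.Dual K (V ⧸ Y)) ∘ₗ Y.mkQ, fun i => ⟨hbt (e i).2, fun h => ?_⟩, ?_⟩
  · refine hli.ne_zero (e i) (LinearMap.ext fun q => ?_)
    obtain ⟨x, rfl⟩ := Y.mkQ_surjective q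
    exact LinearMap.congr_fun h x
  · apply le_antisymm
    · exact le_iInf fun i => hs _ (hbt (e i).2)
    · intro x hx
      rw [Submodule.mem_iInf] at hx
      rw [← Submodule.Quotient.mk_eq_zero, ← Module.forall_dual_apply_eq_zero_iff K]
      intro g
      have hg : g ∈ Submodule.span K b := hb ▸ Submodule.mem_top
      induction hg using Submodule.span_induction with
      | mem g hg => simpa [e] using hx (e.symm ⟨g, hg⟩)
      | zero => simp
      | add g h _ _ hg hh => simp [hg, hh]
      | smul c g _ hg => simp [hg]

theorem mainTheorem1 {X : Type*} [AddCommGroup X] [Lattice X] [IsOrderedAddMonoid X]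
    [Module ℝ X] [IsOrderedModule ℝ X] (hX : IsArchimedeanVectorLattice X)
    (n : ℕ) (Y : Submodule ℝ X) (hY : IsUniformlyClosedSublatticeOfCodim n Y) :
    ∃ Z : Fin n → Submodule ℝ X,
      (∀ i, IsUniformlyClosedSublatticeOfCodim 1 (Z i)) ∧
      Y = ⨅ i, Z i ∧
      ∃ φ : Fin (2 * n) → (X →ₗ[ℝ] ℝ),
        (∀ j, IsRealLatticeHom (φ j)) ∧
        (∀ i : Fin n, Z i =
          LinearMap.ker (φ ⟨2 * i, by omega⟩ - φ ⟨2 * i + 1, by omega⟩)) ∧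
        Y = ⨅ i : Fin n,
          LinearMap.ker (φ ⟨2 * i, by omega⟩ - φ ⟨2 * i + 1, by omega⟩) := by
  have : FiniteDimensional ℝ (X ⧸ Y) :=
    Module.rank_lt_aleph0_iff.1 (hY.codim ▸ Cardinal.natCast_lt_aleph0)
  obtain ⟨F, hF, hFY⟩ := exists_finset_isRealLatticeHom hY.isSublattice
    hY.isUniformlyClosed.containsUniformLimits
  obtain ⟨f, hf, hYf⟩ := exists_fin_iInf_ker_eq hY.codim
    {f | (∃ φ ψ : X →ₗ[ℝ] ℝ, IsRealLatticeHom φ ∧ IsRealLatticeHom ψ ∧ f = φ - ψ) ∧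
      Y ≤ LinearMap.ker f} (fun f hf => hf.2) (fun x hx => by
      obtain ⟨φ, ψ, hφ, hψ, h1, h2⟩ := exists_isRealLatticeHom_sub_ne hY.isSublattice hF hFY hx
      exact ⟨φ - ψ, ⟨⟨φ, ψ, hφ, hψ, rfl⟩, fun y hy => by simp [h1 y hy]⟩, by
        simpa [sub_eq_zero] using h2⟩)
  choose φ ψ hφ hψ hfe using fun i => (hf i).1.1
  let χ : Fin (2 * n) → (X →ₗ[ℝ] ℝ) := fun j =>
    if (j : ℕ) % 2 = 0 then φ ⟨j / 2, by omega⟩ else ψ ⟨j / 2, by omega⟩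
  have hχ : ∀ i : Fin n, χ ⟨2 * i, by omega⟩ - χ ⟨2 * i + 1, by omega⟩ = f i := by
    intro i
    have h1 : χ ⟨2 * i, by omega⟩ = φ i := by simp [χ]
    have h2 : χ ⟨2 * i + 1, by omega⟩ = ψ i := by
      have h3 : (2 * (i : ℕ) + 1) / 2 = i := by omega
      simp [χ, Nat.add_mod, h3]
    rw [h1, h2, hfe]
  refine ⟨fun i => LinearMap.ker (f i), fun i => ?_, hYf, χ, fun j => ?_, fun i => ?_, ?_⟩
  · have h0 := (hf i).2
    simp only [hfe] at h0 ⊢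
    exact (hφ i).isUniformlyClosedSublatticeOfCodim_ker_sub (hψ i) h0
  · by_cases hj : (j : ℕ) % 2 = 0
    · simpa [χ, hj] using hφ _
    · simpa [χ, hj] using hψ _
  · rw [hχ]
  · simpa only [hχ] using hYf
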